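/- All graphs are finite, simple, undirected and connected, and $d$ denotes the distance in $G$. A set $S$ of vertices of a graph $G=(V,E)$ is dominating if every vertex of $V\setminus S$ has a neighbour in $S$, and locating if for any two distinct vertices $u,v\in V$ there is $x\in S$ with $d(u,x)\neq d(v,x)$. Let $\eta(G)$ be the minimum cardinality of a set of vertices of $G$ that is both dominating and locating. **Theorem.** Up to isomorphism there are exactly $51$ graphs $G$ with $\eta(G)=2$. Each of them has between $3$ and $8$ vertices, and there are exactly $2$, $4$, $10$, $15$, $17$ and $3$ of them of order $3$, $4$, $5$, $6$, $7$ and $8$, respectively. -/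

import Mathlib

namespace SimpleGraph

/-- The vector of metric coordinates of `v` with respect to `S`:
the distances from `v` to the elements of `S`. -/
noncomputable def metricCoords {V : Type*} (G : SimpleGraph V) (S : Finset V) (v : V) : S → ℕ :=
  fun x => G.dist v x

/-- `S` is dominating: every vertex outside `S` has a neighbour in `S`. -/
def IsDominatingSet {V : Type*} (G : SimpleGraph V) (S : Finset V) : Prop :=
  ∀ v, v ∉ S → ∃ x ∈ S, G.Adj v x

/-- `S` is locating: distinct vertices have distinct metric coordinates with respect to `S`. -/
def IsLocatingSet {V : Type*} (G : SimpleGraph V) (S : Finset V) : Prop :=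
  ∀ u v, u ≠ v → G.metricCoords S u ≠ G.metricCoords S v

/-- `S` is metric-locating-dominating: it is both dominating and locating. -/
def IsMetricLocatingDominatingSet {V : Type*} (G : SimpleGraph V) (S : Finset V) : Prop :=
  G.IsDominatingSet S ∧ G.IsLocatingSet S

/-- The metric-location-domination number `η(G)` of a (finite, connected) graph: the minimum
cardinality of a metric-locating-dominating set. -/
noncomputable def metricLocationDominationNumber {V : Type*} (G : SimpleGraph V) : ℕ :=
  sInf {k | ∃ S : Finset V, G.IsMetricLocatingDominatingSet S ∧ S.card = k}

/-- In a finite connected graph the set of all vertices is metric-locating-dominating, so the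
minimum that defines `η(G)` is over a nonempty set. -/
theorem Connected.isMetricLocatingDominatingSet_univ {V : Type*} [Fintype V] {G : SimpleGraph V}
    (hG : G.Connected) : G.IsMetricLocatingDominatingSet Finset.univ := by
  refine ⟨fun v hv => absurd (Finset.mem_univ v) hv, fun u v huv h => huv ?_⟩
  have h1 : G.dist u u = G.dist v u := congrFun h ⟨u, Finset.mem_univ u⟩
  rw [SimpleGraph.dist_self] at h1
  exact (hG.dist_eq_zero_iff.mp h1.symm).symm

end SimpleGraph

/-! Let `{a, b}` be a locating and dominating pair, `D = d(a, b)`. Domination forces `D ≤ 3`, and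
every other vertex has one coordinate equal to 1 and the other at most `D + 1 ≤ 4`. This leaves
seven possible coordinate pairs, each taken at most once because the pair is locating. Coordinates
decide all adjacencies with `a` and `b`. Any other edge changes each coordinate by at most one, so
only seven further edges are possible. Hence `G` is encoded by `D`, a set of labels and a set of
optional edges (a chart).

Conversely, a chart comes from a graph exactly when its prescribed coordinates really are distances.
This is a local condition (`IsPotential`): the function varies by at most one along edges and drops
by one along some edge wherever it is nonzero. So a finite search (`exists_mem_table`) finds all
charts. They fall into 51 rows of isomorphic charts, and the isomorphism invariant `twoWalkCubeSum`
takes different values on different rows. -/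

namespace SimpleGraph

/-! ### Distances as potentials, locating pairs, an isomorphism invariant -/

section MetricLocationDomination

variable {V : Type*} {G : SimpleGraph V}

/-- A function that vanishes only at `a`, changes by at most one along edges and decreases by one
along some edge at every other vertex is the distance to `a`. -/
theorem reachable_and_dist_eq_of_potential {f : V → ℕ} {a : V} (h0 : ∀ v, f v = 0 ↔ v = a)
    (h1 : ∀ u v, G.Adj u v → f u ≤ f v + 1)
    (h2 : ∀ v, f v ≠ 0 → ∃ w, G.Adj v w ∧ f w + 1 = f v) (v : V) :
    G.Reachable v a ∧ G.dist v a = f v := by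
  have hwalk : ∀ k v, f v = k → ∃ p : G.Walk v a, p.length = k := by
    intro k
    induction k with
    | zero =>
      intro v hv
      obtain rfl := (h0 v).1 hv
      exact ⟨Walk.nil, rfl⟩
    | succ k ih =>
      intro v hv
      obtain ⟨w, hvw, hw⟩ := h2 v (by omega)
      obtain ⟨p, hp⟩ := ih w (by omega)
      exact ⟨Walk.cons hvw p, by simp [hp]⟩
  have hlow : ∀ {u w : V} (p : G.Walk u w), f u ≤ f w + p.length := by
    intro u w p
    induction p with
    | nil => simp
    | cons h p ih =>
      have := h1 _ _ h
      rw [Walk.length_cons]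
      omega
  obtain ⟨p, hp⟩ := hwalk _ v rfl
  refine ⟨⟨p⟩, le_antisymm (hp ▸ dist_le p) ?_⟩
  obtain ⟨q, hq⟩ := (Walk.reachable p).exists_walk_length_eq_dist
  have := hlow q
  rw [(h0 a).2 rfl] at this
  omega

theorem Connected.exists_adj_dist_add_one_eq (hG : G.Connected) {v a : V} (h : G.dist v a ≠ 0) :
    ∃ w, G.Adj v w ∧ G.dist w a + 1 = G.dist v a := by
  obtain ⟨p, hp⟩ := hG.exists_walk_length_eq_dist v a
  cases p with
  | nil => simp at h
  | cons hvw q =>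
    rename_i w
    refine ⟨w, hvw, ?_⟩
    have h1 := dist_le q
    have h2 : G.dist v a ≤ G.dist v w + G.dist w a := hG.dist_triangle
    rw [dist_eq_one_iff_adj.2 hvw] at h2
    rw [Walk.length_cons] at hp
    omega

theorem Connected.dist_le_dist_add_one (hG : G.Connected) {u v : V} (h : G.Adj u v) (a : V) :
    G.dist u a ≤ G.dist v a + 1 := by
  have h2 : G.dist u a ≤ G.dist u v + G.dist v a := hG.dist_triangle
  rw [dist_eq_one_iff_adj.2 h] at h2
  omega

theorem isLocatingSet_pair_iff [DecidableEq V] {a b : V} :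
    G.IsLocatingSet {a, b} ↔
      ∀ u v, G.dist u a = G.dist v a → G.dist u b = G.dist v b → u = v := by
  constructor
  · intro h u v ha hb
    by_contra huv
    refine h u v huv (funext fun ⟨x, hx⟩ => ?_)
    simp only [Finset.mem_insert, Finset.mem_singleton] at hx
    rcases hx with rfl | rfl <;> assumption
  · intro h u v huv he
    exact huv (h u v (congrFun he ⟨a, by simp⟩) (congrFun he ⟨b, by simp⟩))

theorem metricLocationDominationNumber_le {S : Finset V} (hS : G.IsMetricLocatingDominatingSet S) :
    G.metricLocationDominationNumber ≤ S.card :=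
  Nat.sInf_le ⟨S, hS, rfl⟩

/-- If a set with at most one element is dominating, all vertices outside it are at distance 1 from
its element and share their coordinates. Being locating then leaves at most one such vertex, which
three distinct vertices rule out. -/
theorem metricLocationDominationNumber_eq_two_of_pair [DecidableEq V] {a b c : V} (hab : a ≠ b)
    (hac : a ≠ c) (hbc : b ≠ c) (h : G.IsMetricLocatingDominatingSet {a, b}) :
    G.metricLocationDominationNumber = 2 := by
  have hle := metricLocationDominationNumber_le h
  rw [Finset.card_pair hab] at hle
  obtain ⟨S, ⟨hdom, hloc⟩, hcard⟩ := Nat.sInf_mem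
    (s := {k | ∃ S : Finset V, G.IsMetricLocatingDominatingSet S ∧ S.card = k}) ⟨_, _, h, rfl⟩
  change S.card = G.metricLocationDominationNumber at hcard
  by_contra hne
  have hlt : S.card ≤ 1 := by omega
  have hS : ∀ x ∈ S, ∀ y ∈ S, x = y := Finset.card_le_one.1 hlt
  have key : ∀ u v, u ∉ S → v ∉ S → u = v := by
    intro u v hu hv
    by_contra huv
    refine hloc u v huv (funext fun ⟨x, hx⟩ => ?_)
    obtain ⟨y, hy, huy⟩ := hdom u hu
    obtain ⟨z, hz, hvz⟩ := hdom v hv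
    obtain rfl := hS _ hy _ hx
    obtain rfl := hS _ hz _ hx
    exact (dist_eq_one_iff_adj.2 huy).trans (dist_eq_one_iff_adj.2 hvz).symm
  by_cases ha : a ∈ S
  · exact hbc (key b c (fun hb => hab (hS _ ha _ hb)) (fun hc => hac (hS _ ha _ hc)))
  · by_cases hb : b ∈ S
    · exact hac (key a c ha (fun hc => hbc (hS _ hb _ hc)))
    · exact hab (key a b ha hb)

/-- The data that `η(G) = 2` provides: a locating and dominating pair and a third vertex. -/
theorem Connected.exists_pair_of_metricLocationDominationNumber_eq_two [DecidableEq V]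
    (hG : G.Connected) (h : G.metricLocationDominationNumber = 2) :
    ∃ a b c : V, a ≠ b ∧ c ≠ a ∧ c ≠ b ∧ G.IsMetricLocatingDominatingSet {a, b} := by
  -- The infimum of the empty set is 0, so the value 2 is attained.
  have hne : {k | ∃ S : Finset V, G.IsMetricLocatingDominatingSet S ∧ S.card = k}.Nonempty := by
    by_contra hemp
    rw [Set.not_nonempty_iff_eq_empty] at hemp
    rw [metricLocationDominationNumber, hemp, Nat.sInf_empty] at h
    omega
  obtain ⟨S, hS, hcard⟩ := Nat.sInf_mem hne
  change S.card = G.metricLocationDominationNumber at hcard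
  obtain ⟨a, b, hab, rfl⟩ := Finset.card_eq_two.1 (hcard.trans h)
  by_cases hc : ∃ c, c ≠ a ∧ c ≠ b
  · obtain ⟨c, hca, hcb⟩ := hc
    exact ⟨a, b, c, hab, hca, hcb, hS⟩
  -- With only the vertices `a` and `b`, connectedness makes them adjacent and `{a}` alone suffices,
  -- so the minimum would be at most 1.
  · exfalso
    push Not at hc
    have hadj : G.Adj b a := by
      obtain ⟨w, hw, -⟩ := hG.exists_adj_dist_add_one_eq (v := b) (a := a)
        (fun h0 => hab (hG.dist_eq_zero_iff.1 h0).symm)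
      by_cases hwa : w = a
      · exact hwa ▸ hw
      · exact absurd (hc w hwa ▸ hw) (G.irrefl)
    have hone : G.IsMetricLocatingDominatingSet {a} := by
      constructor
      · intro v hv
        rw [Finset.mem_singleton] at hv
        exact ⟨a, by simp, hc v hv ▸ hadj⟩
      · intro u v huv he
        have he' : G.dist u a = G.dist v a := congrFun he ⟨a, by simp⟩
        have hba : G.dist b a = 1 := dist_eq_one_iff_adj.2 hadj
        by_cases hu : u = a
        · subst hu
          rw [hc v (Ne.symm huv), hba, dist_self] at he'
          omega
        · by_cases hv : v = a
          · subst hv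
            rw [hc u hu, hba, dist_self] at he'
            omega
          · exact huv ((hc u hu).trans (hc v hv).symm)
    have := metricLocationDominationNumber_le hone
    rw [Finset.card_singleton] at this
    omega

/-- The sum over the vertices of the cube of the number of walks of length two. -/
def twoWalkCubeSum [Fintype V] (G : SimpleGraph V) [DecidableRel G.Adj] : ℕ :=
  ∑ v, (∑ w, if G.Adj v w then ∑ u, if G.Adj w u then 1 else 0 else 0) ^ 3

theorem Iso.twoWalkCubeSum_eq [Fintype V] [DecidableRel G.Adj] {W : Type*} [Fintype W]
    {G' : SimpleGraph W} [DecidableRel G'.Adj] (e : G ≃g G') :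
    G.twoWalkCubeSum = G'.twoWalkCubeSum := by
  unfold twoWalkCubeSum
  rw [← Equiv.sum_comp e.toEquiv]
  refine Finset.sum_congr rfl fun v _ => ?_
  rw [← Equiv.sum_comp e.toEquiv]
  congr 1
  refine Finset.sum_congr rfl fun w _ => ?_
  rw [← Equiv.sum_comp e.toEquiv]
  have h : ∀ x y, G'.Adj (e.toEquiv x) (e.toEquiv y) ↔ G.Adj x y := fun _ _ => e.map_adj_iff
  simp only [h]

end MetricLocationDomination

/-! ### Charts and their graphs -/

/-- The graphs with a given locating and dominating pair `a`, `b` are described by charts. A vertex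
is labelled by its pair of distances to `a` and `b`: the labels `0, …, 8` stand for `(0, D)`,
`(D, 0)`, `(1, 1)`, `(1, 2)`, `(2, 1)`, `(1, 3)`, `(3, 1)`, `(1, 4)`, `(4, 1)`, where `D` is the
distance of `a` and `b`. A chart consists of `D`, the labels that occur, and the edges that avoid
`a` and `b`. -/
structure Chart where
  /-- the distance of the two vertices of the pair -/
  sep : ℕ
  /-- the labels that occur -/
  labels : List ℕ
  /-- the edges between labels other than `0` and `1` -/
  edges : List (ℕ × ℕ)

namespace Chart

/-- The distance to `a` of a vertex with label `x`. -/
def distA (D x : ℕ) : ℕ := [0, D, 1, 1, 2, 1, 3, 1, 4].getD x 0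

/-- The distance to `b` of a vertex with label `x`. -/
def distB (D x : ℕ) : ℕ := [D, 0, 1, 2, 1, 3, 1, 4, 1].getD x 0

/-- The pairs of labels other than `0`, `1` whose distances to `a` and to `b` differ by at most
one. -/
def optionalEdges : List (ℕ × ℕ) := [(2, 3), (2, 4), (3, 4), (3, 5), (4, 6), (5, 7), (6, 8)]

/-- Adjacency of labels: it is determined by the distances for the labels `0` and `1`, and by the
list `E` of edges for the others. -/
def adj (D : ℕ) (E : List (ℕ × ℕ)) (x y : ℕ) : Bool :=
  if x = 0 then distA D y == 1
  else if y = 0 then distA D x == 1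
  else if x = 1 then distB D y == 1
  else if y = 1 then distB D x == 1
  else decide ((x, y) ∈ E ∨ (y, x) ∈ E)

theorem adj_comm (D : ℕ) (E : List (ℕ × ℕ)) (x y : ℕ) : adj D E x y = adj D E y x := by
  unfold adj
  split_ifs <;> simp_all [or_comm]

/-- The function `f` satisfies the conditions on a distance function on the labels `P`. -/
def IsPotential (D : ℕ) (P : List ℕ) (E : List (ℕ × ℕ)) (f : ℕ → ℕ) : Prop :=
  (∀ x ∈ P, f x = 0 ∨ ∃ y ∈ P, adj D E x y = true ∧ f y + 1 = f x) ∧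
    ∀ x ∈ P, ∀ y ∈ P, adj D E x y = true → f x ≤ f y + 1

instance (D : ℕ) (P : List ℕ) (E : List (ℕ × ℕ)) (f : ℕ → ℕ) :
    Decidable (IsPotential D P E f) := by
  unfold IsPotential
  infer_instance

/-- The graph of a chart, on the positions of its labels. -/
def graph (c : Chart) : SimpleGraph (Fin c.labels.length) where
  Adj x y := x ≠ y ∧ adj c.sep c.edges c.labels[x] c.labels[y] = true
  symm := ⟨fun x y h => ⟨h.1.symm, by rw [adj_comm]; exact h.2⟩⟩
  loopless := ⟨fun _ h => h.1 rfl⟩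

instance (c : Chart) : DecidableRel c.graph.Adj := fun x y =>
  inferInstanceAs (Decidable (x ≠ y ∧ adj c.sep c.edges c.labels[x] c.labels[y] = true))

/-- The adjacency matrix of a chart. -/
def matrix (c : Chart) : List (List Bool) :=
  c.labels.map fun x => c.labels.map fun y => adj c.sep c.edges x y

/-- When labels are listed in matching order, the isomorphism is the identity on positions, so no
search for a bijection is needed. -/
theorem nonempty_iso_of_matrix_eq {c c' : Chart} (h : c.matrix = c'.matrix) :
    Nonempty (c.graph ≃g c'.graph) := by
  have hlen : c.labels.length = c'.labels.length := by simpa [matrix] using congrArg List.length h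
  have hadj : ∀ (x y : ℕ) (hx : x < c.labels.length) (hy : y < c.labels.length),
      adj c.sep c.edges c.labels[x] c.labels[y] =
        adj c'.sep c'.edges (c'.labels[x]'(hlen ▸ hx)) (c'.labels[y]'(hlen ▸ hy)) := by
    intro x y hx hy
    have h2 := congrArg (fun m : List (List Bool) => (m.getD x []).getD y false) h
    simpa [matrix, hx, hy, ← hlen] using h2
  refine ⟨⟨finCongr hlen, ?_⟩⟩
  intro x y
  simp [graph, hadj x y x.2 y.2, Fin.ext_iff]

/-- The conditions under which the graph of a chart has the labels `0` and `1` as a locating and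
dominating pair. -/
def IsGood (c : Chart) : Prop :=
  c.labels.Nodup ∧ 0 ∈ c.labels ∧ 1 ∈ c.labels ∧ 2 < c.labels.length ∧
    IsPotential c.sep c.labels c.edges (distA c.sep) ∧
    IsPotential c.sep c.labels c.edges (distB c.sep) ∧
    (∀ x ∈ c.labels, (distA c.sep x = 0 ↔ x = 0) ∧ (distB c.sep x = 0 ↔ x = 1) ∧
      (x = 0 ∨ x = 1 ∨ distA c.sep x = 1 ∨ distB c.sep x = 1)) ∧
    ∀ x ∈ c.labels, ∀ y ∈ c.labels,
      distA c.sep x = distA c.sep y → distB c.sep x = distB c.sep y → x = y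

instance (c : Chart) : Decidable c.IsGood := by
  unfold IsGood
  infer_instance

/-- Replaces the computation of distances by decidable local checks; distinct labels make position
`a` the only zero of the potential. -/
theorem reachable_and_dist_eq {c : Chart} (hnd : c.labels.Nodup) {f : ℕ → ℕ}
    (hf : IsPotential c.sep c.labels c.edges f) {a : Fin c.labels.length}
    (h0 : ∀ x ∈ c.labels, f x = 0 ↔ x = c.labels[a]) (v : Fin c.labels.length) :
    c.graph.Reachable v a ∧ c.graph.dist v a = f c.labels[v] := by
  refine reachable_and_dist_eq_of_potential (f := fun v : Fin c.labels.length => f c.labels[v])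
    (fun v => ?_) (fun u v huv => ?_) (fun v hv => ?_) v
  · refine (h0 _ (List.getElem_mem v.2)).trans ?_
    exact (hnd.getElem_inj_iff).trans Fin.ext_iff.symm
  · exact hf.2 _ (List.getElem_mem _) _ (List.getElem_mem _) huv.2
  · obtain h | ⟨y, hy, hadj, hfy⟩ := hf.1 _ (List.getElem_mem v.2)
    · exact absurd h hv
    · obtain ⟨w, hw, rfl⟩ := List.getElem_of_mem hy
      refine ⟨⟨w, hw⟩, ⟨?_, hadj⟩, hfy⟩
      rintro rfl
      exact absurd hfy (by simp)

theorem IsGood.connected_and_eq_two {c : Chart} (hc : c.IsGood) :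
    c.graph.Connected ∧ c.graph.metricLocationDominationNumber = 2 := by
  obtain ⟨hnd, hmem0, hmem1, hlen, hpA, hpB, hlab, hinj⟩ := hc
  obtain ⟨a, ha, ha0⟩ := List.getElem_of_mem hmem0
  obtain ⟨b, hb, hb1⟩ := List.getElem_of_mem hmem1
  have hA := reachable_and_dist_eq hnd hpA (a := ⟨a, ha⟩)
    (fun x hx => by rw [(hlab x hx).1]; exact ha0 ▸ Iff.rfl)
  have hB := reachable_and_dist_eq hnd hpB (a := ⟨b, hb⟩)
    (fun x hx => by rw [(hlab x hx).2.1]; exact hb1 ▸ Iff.rfl)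
  have hab : (⟨a, ha⟩ : Fin c.labels.length) ≠ ⟨b, hb⟩ := by
    intro h
    rw [Fin.mk.injEq] at h
    subst h
    omega
  refine ⟨(connected_iff_exists_forall_reachable _).2 ⟨⟨a, ha⟩, fun v => (hA v).1.symm⟩, ?_⟩
  obtain ⟨k, hk⟩ : ∃ k, k ∉ ({⟨a, ha⟩, ⟨b, hb⟩} : Finset (Fin c.labels.length)) := by
    by_contra! hall
    have h1 := Finset.card_le_card (fun x _ => hall x : Finset.univ ⊆ _)
    rw [Finset.card_pair hab, Finset.card_univ, Fintype.card_fin] at h1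
    omega
  simp only [Finset.mem_insert, Finset.mem_singleton, not_or] at hk
  refine metricLocationDominationNumber_eq_two_of_pair hab (Ne.symm hk.1) (Ne.symm hk.2)
    ⟨fun v hv => ?_, isLocatingSet_pair_iff.2 fun u v h1 h2 => ?_⟩
  · simp only [Finset.mem_insert, Finset.mem_singleton, not_or] at hv
    obtain h | h | h | h := (hlab _ (List.getElem_mem v.2)).2.2
    · exact absurd (Fin.ext ((hnd.getElem_inj_iff).1 (h.trans ha0.symm))) hv.1
    · exact absurd (Fin.ext ((hnd.getElem_inj_iff).1 (h.trans hb1.symm))) hv.2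
    · exact ⟨⟨a, ha⟩, by simp, dist_eq_one_iff_adj.1 ((hA v).2.trans h)⟩
    · exact ⟨⟨b, hb⟩, by simp, dist_eq_one_iff_adj.1 ((hB v).2.trans h)⟩
  · rw [(hA u).2, (hA v).2] at h1
    rw [(hB u).2, (hB v).2] at h2
    exact Fin.ext ((hnd.getElem_inj_iff).1
      (hinj _ (List.getElem_mem u.2) _ (List.getElem_mem v.2) h1 h2))

/-! ### The table of charts and its verification -/

/-- The charts of the graphs with `η = 2`, one row for each graph. A row consists of a
representative and the other charts of the same graph, with the labels in matching order. -/
def table : List (Chart × List Chart) :=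
  [
    (⟨1, [0, 1, 2], []⟩,
      []),
    (⟨1, [0, 1, 3], []⟩,
      [⟨1, [1, 0, 4], []⟩,
       ⟨2, [2, 0, 1], []⟩]),
    (⟨1, [0, 1, 2, 3], []⟩,
      [⟨1, [1, 0, 2, 4], []⟩,
       ⟨2, [2, 0, 3, 1], [(2, 3)]⟩,
       ⟨2, [2, 1, 4, 0], [(2, 4)]⟩]),
    (⟨1, [0, 1, 2, 3], [(2, 3)]⟩,
      [⟨1, [1, 0, 2, 4], [(2, 4)]⟩]),
    (⟨1, [0, 1, 3, 4], []⟩,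
      [⟨2, [0, 2, 5, 1], []⟩,
       ⟨2, [1, 2, 6, 0], []⟩,
       ⟨3, [3, 4, 0, 1], [(3, 4)]⟩]),
    (⟨1, [0, 1, 3, 4], [(3, 4)]⟩,
      []),
    (⟨1, [0, 1, 2, 3, 4], []⟩,
      [⟨2, [0, 2, 3, 5, 1], [(2, 3)]⟩,
       ⟨2, [1, 2, 4, 6, 0], [(2, 4)]⟩]),
    (⟨1, [0, 1, 2, 3, 4], [(2, 3)]⟩,
      [⟨1, [1, 0, 2, 4, 3], [(2, 4)]⟩,
       ⟨2, [0, 2, 3, 5, 1], [(2, 3), (3, 5)]⟩,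
       ⟨2, [1, 2, 4, 6, 0], [(2, 4), (4, 6)]⟩]),
    (⟨1, [0, 1, 2, 3, 4], [(2, 3), (2, 4)]⟩,
      [⟨2, [3, 4, 2, 0, 1], [(2, 3), (2, 4), (3, 4)]⟩]),
    (⟨1, [0, 1, 2, 3, 4], [(3, 4)]⟩,
      [⟨2, [2, 3, 0, 1, 4], [(2, 3), (3, 4)]⟩,
       ⟨2, [2, 4, 1, 0, 3], [(2, 4), (3, 4)]⟩]),
    (⟨1, [0, 1, 2, 3, 4], [(2, 3), (3, 4)]⟩,
      [⟨1, [1, 0, 2, 4, 3], [(2, 4), (3, 4)]⟩]),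
    (⟨1, [0, 1, 2, 3, 4], [(2, 3), (2, 4), (3, 4)]⟩,
      []),
    (⟨2, [0, 1, 2, 3, 4], [(2, 3), (2, 4)]⟩,
      []),
    (⟨2, [0, 1, 2, 3, 4], [(3, 4)]⟩,
      []),
    (⟨2, [0, 1, 2, 4, 5], [(2, 4)]⟩,
      [⟨2, [1, 0, 2, 3, 6], [(2, 3)]⟩,
       ⟨3, [4, 0, 3, 5, 1], [(3, 4), (3, 5)]⟩,
       ⟨3, [3, 1, 4, 6, 0], [(3, 4), (4, 6)]⟩]),
    (⟨2, [0, 1, 2, 5, 6], []⟩,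
      [⟨3, [0, 4, 3, 7, 1], [(3, 4)]⟩,
       ⟨3, [1, 3, 4, 8, 0], [(3, 4)]⟩]),
    (⟨2, [0, 1, 2, 3, 4, 5], [(2, 3), (2, 4)]⟩,
      [⟨2, [1, 0, 2, 4, 3, 6], [(2, 3), (2, 4)]⟩]),
    (⟨2, [0, 1, 2, 3, 4, 5], [(3, 4)]⟩,
      [⟨2, [1, 0, 2, 4, 3, 6], [(3, 4)]⟩]),
    (⟨2, [0, 1, 2, 3, 4, 5], [(2, 3), (3, 4)]⟩,
      [⟨2, [1, 0, 2, 4, 3, 6], [(2, 4), (3, 4)]⟩]),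
    (⟨2, [0, 1, 2, 3, 4, 5], [(2, 4), (3, 4)]⟩,
      [⟨2, [1, 0, 2, 4, 3, 6], [(2, 3), (3, 4)]⟩]),
    (⟨2, [0, 1, 2, 3, 4, 5], [(2, 3), (2, 4), (3, 4)]⟩,
      [⟨2, [1, 0, 2, 4, 3, 6], [(2, 3), (2, 4), (3, 4)]⟩]),
    (⟨2, [0, 1, 2, 3, 4, 5], [(2, 3), (2, 4), (3, 5)]⟩,
      [⟨2, [1, 0, 2, 4, 3, 6], [(2, 3), (2, 4), (4, 6)]⟩]),
    (⟨2, [0, 1, 2, 3, 4, 5], [(3, 4), (3, 5)]⟩,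
      [⟨2, [1, 0, 2, 4, 3, 6], [(3, 4), (4, 6)]⟩]),
    (⟨2, [0, 1, 2, 3, 4, 5], [(2, 3), (3, 4), (3, 5)]⟩,
      [⟨2, [1, 0, 2, 4, 3, 6], [(2, 4), (3, 4), (4, 6)]⟩]),
    (⟨2, [0, 1, 2, 3, 4, 5], [(2, 4), (3, 4), (3, 5)]⟩,
      [⟨2, [1, 0, 2, 4, 3, 6], [(2, 3), (3, 4), (4, 6)]⟩]),
    (⟨2, [0, 1, 2, 3, 4, 5], [(2, 3), (2, 4), (3, 4), (3, 5)]⟩,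
      [⟨2, [1, 0, 2, 4, 3, 6], [(2, 3), (2, 4), (3, 4), (4, 6)]⟩]),
    (⟨2, [0, 1, 2, 3, 5, 6], [(2, 3)]⟩,
      [⟨2, [1, 0, 2, 4, 6, 5], [(2, 4)]⟩,
       ⟨3, [0, 4, 3, 5, 7, 1], [(3, 4), (3, 5)]⟩,
       ⟨3, [1, 3, 4, 6, 8, 0], [(3, 4), (4, 6)]⟩]),
    (⟨2, [0, 1, 2, 3, 5, 6], [(2, 3), (3, 5)]⟩,
      [⟨2, [1, 0, 2, 4, 6, 5], [(2, 4), (4, 6)]⟩,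
       ⟨3, [0, 4, 3, 5, 7, 1], [(3, 4), (3, 5), (5, 7)]⟩,
       ⟨3, [1, 3, 4, 6, 8, 0], [(3, 4), (4, 6), (6, 8)]⟩]),
    (⟨3, [0, 1, 3, 4, 5, 6], [(3, 4), (3, 5), (4, 6)]⟩,
      []),
    (⟨3, [0, 1, 3, 4, 6, 7], [(3, 4), (4, 6)]⟩,
      [⟨3, [1, 0, 4, 3, 5, 8], [(3, 4), (3, 5)]⟩]),
    (⟨3, [0, 1, 3, 4, 7, 8], [(3, 4)]⟩,
      []),
    (⟨2, [0, 1, 2, 3, 4, 5, 6], [(2, 3), (2, 4)]⟩,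
      []),
    (⟨2, [0, 1, 2, 3, 4, 5, 6], [(3, 4)]⟩,
      []),
    (⟨2, [0, 1, 2, 3, 4, 5, 6], [(2, 3), (3, 4)]⟩,
      [⟨2, [1, 0, 2, 4, 3, 6, 5], [(2, 4), (3, 4)]⟩]),
    (⟨2, [0, 1, 2, 3, 4, 5, 6], [(2, 3), (2, 4), (3, 4)]⟩,
      []),
    (⟨2, [0, 1, 2, 3, 4, 5, 6], [(2, 3), (2, 4), (3, 5)]⟩,
      [⟨2, [1, 0, 2, 4, 3, 6, 5], [(2, 3), (2, 4), (4, 6)]⟩]),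
    (⟨2, [0, 1, 2, 3, 4, 5, 6], [(3, 4), (3, 5)]⟩,
      [⟨2, [1, 0, 2, 4, 3, 6, 5], [(3, 4), (4, 6)]⟩]),
    (⟨2, [0, 1, 2, 3, 4, 5, 6], [(2, 3), (3, 4), (3, 5)]⟩,
      [⟨2, [1, 0, 2, 4, 3, 6, 5], [(2, 4), (3, 4), (4, 6)]⟩]),
    (⟨2, [0, 1, 2, 3, 4, 5, 6], [(2, 4), (3, 4), (3, 5)]⟩,
      [⟨2, [1, 0, 2, 4, 3, 6, 5], [(2, 3), (3, 4), (4, 6)]⟩]),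
    (⟨2, [0, 1, 2, 3, 4, 5, 6], [(2, 3), (2, 4), (3, 4), (3, 5)]⟩,
      [⟨2, [1, 0, 2, 4, 3, 6, 5], [(2, 3), (2, 4), (3, 4), (4, 6)]⟩]),
    (⟨2, [0, 1, 2, 3, 4, 5, 6], [(2, 3), (2, 4), (3, 5), (4, 6)]⟩,
      []),
    (⟨2, [0, 1, 2, 3, 4, 5, 6], [(3, 4), (3, 5), (4, 6)]⟩,
      []),
    (⟨2, [0, 1, 2, 3, 4, 5, 6], [(2, 3), (3, 4), (3, 5), (4, 6)]⟩,
      [⟨2, [1, 0, 2, 4, 3, 6, 5], [(2, 4), (3, 4), (3, 5), (4, 6)]⟩]),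
    (⟨2, [0, 1, 2, 3, 4, 5, 6], [(2, 3), (2, 4), (3, 4), (3, 5), (4, 6)]⟩,
      []),
    (⟨3, [0, 1, 3, 4, 5, 6, 7], [(3, 4), (3, 5), (4, 6)]⟩,
      [⟨3, [1, 0, 4, 3, 6, 5, 8], [(3, 4), (3, 5), (4, 6)]⟩]),
    (⟨3, [0, 1, 3, 4, 5, 6, 7], [(3, 4), (3, 5), (4, 6), (5, 7)]⟩,
      [⟨3, [1, 0, 4, 3, 6, 5, 8], [(3, 4), (3, 5), (4, 6), (6, 8)]⟩]),
    (⟨3, [0, 1, 3, 4, 5, 7, 8], [(3, 4), (3, 5)]⟩,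
      [⟨3, [1, 0, 4, 3, 6, 8, 7], [(3, 4), (4, 6)]⟩]),
    (⟨3, [0, 1, 3, 4, 5, 7, 8], [(3, 4), (3, 5), (5, 7)]⟩,
      [⟨3, [1, 0, 4, 3, 6, 8, 7], [(3, 4), (4, 6), (6, 8)]⟩]),
    (⟨3, [0, 1, 3, 4, 5, 6, 7, 8], [(3, 4), (3, 5), (4, 6)]⟩,
      []),
    (⟨3, [0, 1, 3, 4, 5, 6, 7, 8], [(3, 4), (3, 5), (4, 6), (5, 7)]⟩,
      [⟨3, [1, 0, 4, 3, 6, 5, 8, 7], [(3, 4), (3, 5), (4, 6), (6, 8)]⟩]),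
    (⟨3, [0, 1, 3, 4, 5, 6, 7, 8], [(3, 4), (3, 5), (4, 6), (5, 7), (6, 8)]⟩,
      [])  ]

/-- The representative of a row of `table`. -/
def rep (i : Fin 51) : Chart := (table[i]'(i.2.trans_eq rfl)).1

theorem isGood_rep (i : Fin 51) : (rep i).IsGood := by
  revert i
  decide +kernel

theorem matrix_eq_of_mem_table : ∀ r ∈ table, ∀ c ∈ r.2, c.matrix = r.1.matrix := by
  decide +kernel

/-- The values of `twoWalkCubeSum` on the representatives. -/
def cubeSums : List ℕ :=
  [192, 24, 402, 1118, 70, 256, 702, 1610, 3144, 1152, 2698, 5728, 1376, 320, 538, 134,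
   1874, 530, 1644, 1530, 3942, 3106, 1216, 3142, 2480, 6142, 874, 1824, 1186, 626, 198,
   2426, 770, 2070, 4806, 3718, 1486, 3658, 3068, 7138, 5076, 2358, 4860, 9824, 1564,
   2562, 962, 1912, 1942, 2940, 3938]

theorem twoWalkCubeSum_rep (i : Fin 51) : (rep i).graph.twoWalkCubeSum = cubeSums.getD i 0 := by
  revert i
  decide +kernel

theorem getD_cubeSums_injective : ∀ i j : Fin 51, cubeSums.getD i 0 = cubeSums.getD j 0 → i = j := by
  decide +kernel

theorem isEmpty_iso_rep {i j : Fin 51} (hij : i ≠ j) :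
    IsEmpty ((rep i).graph ≃g (rep j).graph) := by
  refine ⟨fun e => hij ?_⟩
  have h := e.twoWalkCubeSum_eq
  rw [twoWalkCubeSum_rep, twoWalkCubeSum_rep] at h
  exact getD_cubeSums_injective i j h

/-- The exhaustive search. Labels agree only up to `Perm`, since the rows order them to align the
adjacency matrices. -/
theorem exists_mem_table : ∀ D ∈ [1, 2, 3], ∀ Q ∈ [2, 3, 4, 5, 6, 7, 8].sublists, Q ≠ [] →
    ∀ E ∈ (optionalEdges.filter fun e => decide (e.1 ∈ Q ∧ e.2 ∈ Q)).sublists,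
      IsPotential D (0 :: 1 :: Q) E (distA D) → IsPotential D (0 :: 1 :: Q) E (distB D) →
        ∃ r ∈ table, ∃ c ∈ r.1 :: r.2, c.sep = D ∧ c.edges = E ∧ c.labels.Perm (0 :: 1 :: Q) := by
  decide +kernel

theorem exists_rep {D : ℕ} (hD : D ∈ [1, 2, 3]) {Q : List ℕ}
    (hQ : Q ∈ [2, 3, 4, 5, 6, 7, 8].sublists) (hQ0 : Q ≠ []) {E : List (ℕ × ℕ)}
    (hE : E ∈ (optionalEdges.filter fun e => decide (e.1 ∈ Q ∧ e.2 ∈ Q)).sublists)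
    (hA : IsPotential D (0 :: 1 :: Q) E (distA D)) (hB : IsPotential D (0 :: 1 :: Q) E (distB D)) :
    ∃ i : Fin 51, ∃ c : Chart, Nonempty (c.graph ≃g (rep i).graph) ∧
      c.sep = D ∧ c.edges = E ∧ c.labels.Perm (0 :: 1 :: Q) := by
  obtain ⟨r, hr, c, hc, h⟩ := exists_mem_table D hD Q hQ hQ0 E hE hA hB
  obtain ⟨i, hi, rfl⟩ := List.getElem_of_mem hr
  refine ⟨⟨i, hi⟩, c, ?_, h⟩
  obtain rfl | hc := List.mem_cons.1 hc
  · exact ⟨Iso.refl⟩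
  · exact nonempty_iso_of_matrix_eq (matrix_eq_of_mem_table _ hr c hc)

/-- The separation 0 is a placeholder: the coordinates of labels from 2 on do not depend on it. -/
theorem mem_optionalEdges_of_dist : ∀ x ∈ [2, 3, 4, 5, 6, 7, 8], ∀ y ∈ [2, 3, 4, 5, 6, 7, 8],
    x ≠ y → distA 0 x ≤ distA 0 y + 1 → distA 0 y ≤ distA 0 x + 1 →
      distB 0 x ≤ distB 0 y + 1 → distB 0 y ≤ distB 0 x + 1 →
        (x, y) ∈ optionalEdges ∨ (y, x) ∈ optionalEdges := by
  decide +kernel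

theorem distA_eq {D x : ℕ} (hx : x ∈ [2, 3, 4, 5, 6, 7, 8]) : distA D x = distA 0 x := by
  fin_cases hx <;> rfl

theorem distB_eq {D x : ℕ} (hx : x ∈ [2, 3, 4, 5, 6, 7, 8]) : distB D x = distB 0 x := by
  fin_cases hx <;> rfl

/-! ### Every graph with the property comes from a chart -/

section Classification

variable {V : Type*} {G : SimpleGraph V}

/-- The two vertices of a dominating pair have distance at most three. -/
theorem dist_mem_of_isDominatingSet [DecidableEq V] (hG : G.Connected) {a b : V} (hab : a ≠ b)
    (hdom : G.IsDominatingSet {a, b}) : G.dist a b ∈ [1, 2, 3] := by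
  have h0 : G.dist a b ≠ 0 := fun h => hab (hG.dist_eq_zero_iff.1 h)
  by_contra hD
  have h4 : 4 ≤ G.dist a b := by
    simp only [List.mem_cons, List.not_mem_nil, or_false] at hD
    omega
  -- Two steps along a shortest path from `a` to `b` lead to a vertex `w` at distance at least 2
  -- from both, which is not dominated.
  obtain ⟨v, hv, hvd⟩ := hG.exists_adj_dist_add_one_eq h0
  obtain ⟨w, hw, hwd⟩ := hG.exists_adj_dist_add_one_eq (v := v) (a := b) (by omega)
  have h3 : G.dist a b ≤ G.dist a w + G.dist w b := hG.dist_triangle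
  have hwa : w ≠ a := by
    rintro rfl
    omega
  have hwb : w ≠ b := by
    rintro rfl
    rw [dist_self] at hwd
    omega
  obtain ⟨x, hx, hwx⟩ := hdom w (by simp [hwa, hwb])
  have hwx' := dist_eq_one_iff_adj.2 hwx
  simp only [Finset.mem_insert, Finset.mem_singleton] at hx
  obtain rfl | rfl := hx
  · rw [dist_comm] at hwx'
    omega
  · omega

theorem exists_label [DecidableEq V] (hG : G.Connected) {a b : V} (hab : a ≠ b)
    (hdom : G.IsDominatingSet {a, b}) (v : V) :
    ∃ x ∈ [0, 1, 2, 3, 4, 5, 6, 7, 8], (x = 0 ↔ v = a) ∧ (x = 1 ↔ v = b) ∧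
      G.dist v a = distA (G.dist a b) x ∧ G.dist v b = distB (G.dist a b) x := by
  have hD := dist_mem_of_isDominatingSet hG hab hdom
  simp only [List.mem_cons, List.not_mem_nil, or_false] at hD
  by_cases ha : v = a
  · subst ha
    exact ⟨0, by simp, by simp, by simpa using hab, by simp [distA], by simp [distB]⟩
  by_cases hb : v = b
  · subst hb
    exact ⟨1, by simp, by simpa using ha, by simp, by simp [distA, dist_comm], by simp [distB]⟩
  have ha0 : G.dist v a ≠ 0 := fun h => ha (hG.dist_eq_zero_iff.1 h)
  have hb0 : G.dist v b ≠ 0 := fun h => hb (hG.dist_eq_zero_iff.1 h)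
  have h1 : G.dist v b ≤ G.dist v a + G.dist a b := hG.dist_triangle
  have h2 : G.dist v a ≤ G.dist v b + G.dist b a := hG.dist_triangle
  rw [G.dist_comm (u := b)] at h2
  have h3 : G.dist v a = 1 ∨ G.dist v b = 1 := by
    obtain ⟨x, hx, hvx⟩ := hdom v (by simp [ha, hb])
    simp only [Finset.mem_insert, Finset.mem_singleton] at hx
    obtain rfl | rfl := hx
    · exact Or.inl (dist_eq_one_iff_adj.2 hvx)
    · exact Or.inr (dist_eq_one_iff_adj.2 hvx)
  -- One coordinate is 1, and the triangle inequality bounds the other by `D + 1 ≤ 4`.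
  have h4 : (G.dist v a = 1 ∧ G.dist v b = 1) ∨ (G.dist v a = 1 ∧ G.dist v b = 2) ∨
      (G.dist v a = 2 ∧ G.dist v b = 1) ∨ (G.dist v a = 1 ∧ G.dist v b = 3) ∨
      (G.dist v a = 3 ∧ G.dist v b = 1) ∨ (G.dist v a = 1 ∧ G.dist v b = 4) ∨
      (G.dist v a = 4 ∧ G.dist v b = 1) := by
    omega
  obtain h | h | h | h | h | h | h := h4
  · exact ⟨2, by simp, by simpa using ha, by simpa using hb, h⟩
  · exact ⟨3, by simp, by simpa using ha, by simpa using hb, h⟩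
  · exact ⟨4, by simp, by simpa using ha, by simpa using hb, h⟩
  · exact ⟨5, by simp, by simpa using ha, by simpa using hb, h⟩
  · exact ⟨6, by simp, by simpa using ha, by simpa using hb, h⟩
  · exact ⟨7, by simp, by simpa using ha, by simpa using hb, h⟩
  · exact ⟨8, by simp, by simpa using ha, by simpa using hb, h⟩

/-- A labelling of the vertices that enumerates the labels of a chart without repetition and turns
adjacency into adjacency of labels is an isomorphism onto the graph of the chart. -/
theorem nonempty_iso_graph {c : Chart} (hnd : c.labels.Nodup) {lab : V → ℕ}
    (hinj : Function.Injective lab) (hlab : ∀ x, x ∈ c.labels ↔ ∃ v, lab v = x)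
    (hadj : ∀ u v, G.Adj u v ↔ u ≠ v ∧ adj c.sep c.edges (lab u) (lab v) = true) :
    Nonempty (G ≃g c.graph) := by
  choose g hg using fun i : Fin c.labels.length => (hlab c.labels[i]).1 (List.getElem_mem i.2)
  have hbij : Function.Bijective g := by
    constructor
    · intro i j hij
      have := congrArg lab hij
      rw [hg, hg] at this
      exact Fin.ext ((hnd.getElem_inj_iff).1 this)
    · intro v
      obtain ⟨i, hi, hiv⟩ := List.getElem_of_mem ((hlab (lab v)).2 ⟨v, rfl⟩)
      exact ⟨⟨i, hi⟩, hinj ((hg _).trans hiv)⟩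
  refine ⟨(⟨Equiv.ofBijective g hbij, ?_⟩ : c.graph ≃g G).symm⟩
  intro i j
  rw [Equiv.ofBijective_apply, Equiv.ofBijective_apply, hadj, hg, hg, hbij.1.ne_iff]
  rfl

theorem exists_iso_rep (hG : G.Connected) (h : G.metricLocationDominationNumber = 2) :
    ∃ i, Nonempty (G ≃g (rep i).graph) := by
  classical
  obtain ⟨a, b, t, hab, hta, htb, hdom, hloc⟩ :=
    hG.exists_pair_of_metricLocationDominationNumber_eq_two h
  rw [isLocatingSet_pair_iff] at hloc
  have hD := dist_mem_of_isDominatingSet hG hab hdom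
  choose lab hmem hlab0 hlab1 hlabA hlabB using exists_label hG hab hdom
  set D := G.dist a b
  have hinj : Function.Injective lab := fun u v huv =>
    hloc u v (by rw [hlabA, hlabA, huv]) (by rw [hlabB, hlabB, huv])
  have hmem2 : ∀ v, v ≠ a → v ≠ b → lab v ∈ [2, 3, 4, 5, 6, 7, 8] := by
    intro v hva hvb
    obtain h | h | h := (by simpa only [List.mem_cons] using hmem v :
      lab v = 0 ∨ lab v = 1 ∨ lab v ∈ [2, 3, 4, 5, 6, 7, 8])
    · exact absurd ((hlab0 v).1 h) hva
    · exact absurd ((hlab1 v).1 h) hvb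
    · exact h
  -- `Q` and `E` below are obtained by filtering so that they are literally sublists met by the
  -- exhaustive search.
  let Q : List ℕ := [2, 3, 4, 5, 6, 7, 8].filter fun x => decide (∃ v, lab v = x)
  have hP : ∀ x, x ∈ 0 :: 1 :: Q ↔ ∃ v, lab v = x := by
    intro x
    constructor
    · intro hx
      obtain rfl | rfl | hx := (by simpa only [List.mem_cons] using hx : x = 0 ∨ x = 1 ∨ x ∈ Q)
      · exact ⟨a, (hlab0 a).2 rfl⟩
      · exact ⟨b, (hlab1 b).2 rfl⟩
      · exact of_decide_eq_true (List.mem_filter.1 hx).2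
    · rintro ⟨v, rfl⟩
      by_cases hva : v = a
      · rw [(hlab0 v).2 hva]
        simp
      by_cases hvb : v = b
      · rw [(hlab1 v).2 hvb]
        simp
      · exact List.mem_cons_of_mem _ (List.mem_cons_of_mem _
          (List.mem_filter.2 ⟨hmem2 v hva hvb, decide_eq_true ⟨v, rfl⟩⟩))
  let E : List (ℕ × ℕ) := (optionalEdges.filter fun e => decide (e.1 ∈ Q ∧ e.2 ∈ Q)).filter
    fun e => decide (∃ u v, lab u = e.1 ∧ lab v = e.2 ∧ G.Adj u v)
  have hE : ∀ u v, (lab u, lab v) ∈ E → G.Adj u v := by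
    intro u v huv
    obtain ⟨u', v', hu, hv, h'⟩ := of_decide_eq_true (List.mem_filter.1 huv).2
    exact hinj hu ▸ hinj hv ▸ h'
  have hadj : ∀ u v, G.Adj u v ↔ adj D E (lab u) (lab v) = true := by
    intro u v
    unfold adj
    split_ifs with h1 h2 h3 h4
    · rw [← hlabA, (hlab0 u).1 h1, beq_iff_eq, dist_eq_one_iff_adj, G.adj_comm]
    · rw [← hlabA, (hlab0 v).1 h2, beq_iff_eq, dist_eq_one_iff_adj]
    · rw [← hlabB, (hlab1 u).1 h3, beq_iff_eq, dist_eq_one_iff_adj, G.adj_comm]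
    · rw [← hlabB, (hlab1 v).1 h4, beq_iff_eq, dist_eq_one_iff_adj]
    · rw [decide_eq_true_iff]
      constructor
      · intro huv
        have hu := hmem2 u (fun e => h1 ((hlab0 u).2 e)) (fun e => h3 ((hlab1 u).2 e))
        have hv := hmem2 v (fun e => h2 ((hlab0 v).2 e)) (fun e => h4 ((hlab1 v).2 e))
        have huQ : lab u ∈ Q := List.mem_filter.2 ⟨hu, decide_eq_true ⟨u, rfl⟩⟩
        have hvQ : lab v ∈ Q := List.mem_filter.2 ⟨hv, decide_eq_true ⟨v, rfl⟩⟩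
        have hopt := mem_optionalEdges_of_dist _ hu _ hv (hinj.ne huv.ne)
        rw [← distA_eq (D := D) hu, ← distA_eq (D := D) hv, ← distB_eq (D := D) hu,
          ← distB_eq (D := D) hv, ← hlabA, ← hlabA, ← hlabB, ← hlabB] at hopt
        obtain h | h := hopt (hG.dist_le_dist_add_one huv a) (hG.dist_le_dist_add_one huv.symm a)
          (hG.dist_le_dist_add_one huv b) (hG.dist_le_dist_add_one huv.symm b)
        · exact Or.inl (List.mem_filter.2 ⟨List.mem_filter.2 ⟨h, decide_eq_true ⟨huQ, hvQ⟩⟩,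
            decide_eq_true ⟨u, v, rfl, rfl, huv⟩⟩)
        · exact Or.inr (List.mem_filter.2 ⟨List.mem_filter.2 ⟨h, decide_eq_true ⟨hvQ, huQ⟩⟩,
            decide_eq_true ⟨v, u, rfl, rfl, huv.symm⟩⟩)
      · rintro (huv | huv)
        · exact hE u v huv
        · exact (hE v u huv).symm
  -- Distances in a connected graph are potentials, so the chart read off from `G` passes the test
  -- of the search.
  have hpot : ∀ (f : ℕ → ℕ) (d : V), (∀ v, G.dist v d = f (lab v)) →
      IsPotential D (0 :: 1 :: Q) E f := by
    intro f d hf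
    constructor
    · intro x hx
      obtain ⟨v, rfl⟩ := (hP x).1 hx
      refine or_iff_not_imp_left.2 fun h0 => ?_
      obtain ⟨w, hw, hwd⟩ := hG.exists_adj_dist_add_one_eq (v := v) (a := d) (by rwa [hf])
      exact ⟨lab w, (hP _).2 ⟨w, rfl⟩, (hadj _ _).1 hw, by rw [← hf, ← hf, hwd]⟩
    · intro x hx y hy hxy
      obtain ⟨u, rfl⟩ := (hP x).1 hx
      obtain ⟨v, rfl⟩ := (hP y).1 hy
      rw [← hf, ← hf]
      exact hG.dist_le_dist_add_one ((hadj u v).2 hxy) d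
  -- The third vertex `t` provides a label.
  have hQ0 : Q ≠ [] := List.ne_nil_of_mem
    (List.mem_filter.2 ⟨hmem2 t hta htb, decide_eq_true ⟨t, rfl⟩⟩)
  have hnd : (0 :: 1 :: Q).Nodup := by
    have : ([0, 1, 2, 3, 4, 5, 6, 7, 8] : List ℕ).Nodup := by decide
    exact this.sublist ((List.filter_sublist.cons_cons 1).cons_cons 0)
  obtain ⟨i, c, ⟨e⟩, hsep, hedges, hperm⟩ := exists_rep hD
    (List.mem_sublists.2 List.filter_sublist) hQ0 (List.mem_sublists.2 List.filter_sublist)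
    (hpot _ a hlabA) (hpot _ b hlabB)
  obtain ⟨e'⟩ := nonempty_iso_graph (G := G) (c := c) (hperm.nodup_iff.2 hnd) hinj
    (fun x => hperm.mem_iff.trans (hP x)) (fun u v => by
      rw [hsep, hedges, ← hadj u v]
      exact ⟨fun huv => ⟨huv.ne, huv⟩, And.right⟩)
  exact ⟨i, ⟨e'.trans e⟩⟩

end Classification

/-! ### Orders of the representatives and the theorem -/

theorem length_labels_rep (i : Fin 51) :
    3 ≤ (rep i).labels.length ∧ (rep i).labels.length ≤ 8 := by
  revert i
  decide +kernel

end Chart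

end SimpleGraph

theorem mainTheorem7 :
    ∃ (n : Fin 51 → ℕ) (H : (i : Fin 51) → SimpleGraph (Fin (n i))),
      -- each of the 51 graphs is connected and has `η = 2`
      (∀ i, (H i).Connected ∧ (H i).metricLocationDominationNumber = 2) ∧
      -- they are pairwise non-isomorphic
      (∀ i j, i ≠ j → IsEmpty (H i ≃g H j)) ∧
      -- every finite connected graph with `η = 2` has between 3 and 8 vertices
      -- and is isomorphic to one of them
      (∀ (V : Type*) [Finite V] (G : SimpleGraph V),
        G.Connected → G.metricLocationDominationNumber = 2 →
          3 ≤ Nat.card V ∧ Nat.card V ≤ 8 ∧ ∃ i, Nonempty (G ≃g H i)) ∧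
      -- the number of them of each order
      Nat.card {i // n i = 3} = 2 ∧
      Nat.card {i // n i = 4} = 4 ∧
      Nat.card {i // n i = 5} = 10 ∧
      Nat.card {i // n i = 6} = 15 ∧
      Nat.card {i // n i = 7} = 17 ∧
      Nat.card {i // n i = 8} = 3 := by
  refine ⟨fun i => (SimpleGraph.Chart.rep i).labels.length,
    fun i => (SimpleGraph.Chart.rep i).graph,
    fun i => (SimpleGraph.Chart.isGood_rep i).connected_and_eq_two,
    fun i j hij => SimpleGraph.Chart.isEmpty_iso_rep hij, ?_, ?_⟩
  · intro V _ G hG h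
    obtain ⟨i, ⟨e⟩⟩ := SimpleGraph.Chart.exists_iso_rep hG h
    have hcard : Nat.card V = (SimpleGraph.Chart.rep i).labels.length := by
      rw [Nat.card_congr e.toEquiv, Nat.card_fin]
    rw [hcard]
    exact ⟨(SimpleGraph.Chart.length_labels_rep i).1, (SimpleGraph.Chart.length_labels_rep i).2,
      i, ⟨e⟩⟩
  · simp only [Nat.card_eq_fintype_card]
    decide +kernel
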